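/- Let $\mathbb{T}=\mathbb{R}/\mathbb{Z}$ and, for a positive integer $n$, let $T_n:\mathbb{T}\to\mathbb{T}$ be the map $T_n(x)=nx \pmod 1$. Let $\alpha>0$ and let $\Sigma\subset\{1,2,3,\dots\}$ be a set of positive integers closed under multiplication with $$\liminf_{N\to\infty}\frac{\#\left(\Sigma\cap[1,N]\right)}{N^{\alpha}}>0 .$$ Let $\mu$ be a Borel probability measure on $\mathbb{T}$ that is invariant under $T_n$ for every $n\in\Sigma$ and ergodic for the action of the whole semigroup $\Sigma$ (every Borel set $A$ with $\mu(T_n^{-1}A\,\triangle\,A)=0$ for all $n\in\Sigma$ has $\mu(A)\in\{0,1\}$). Suppose that the measure-theoretic (Kolmogorov–Sinai) entropy satisfies $h_\mu(T_p)=0$ for some $p\in\Sigma$ with $p\ge 2$. Then $\mu$ has finite support. -/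

import Mathlib

open MeasureTheory Filter

noncomputable section

/-- The finite partition of `X` into the level sets `ξ ⁻¹' {j}` of a map `ξ : X → ι` has Shannon
entropy `H_μ(ξ) = ∑ j, -μ(ξ ⁻¹' {j}) log μ(ξ ⁻¹' {j})` (empty cells contribute `0`). -/
def partitionEntropy {X : Type*} [MeasurableSpace X] (μ : Measure X) {ι : Type*} [Fintype ι]
    (ξ : X → ι) : ℝ :=
  ∑ j, Real.negMulLog (μ.real (ξ ⁻¹' {j}))

/-- The refinement `ξ ∨ T⁻¹ ξ ∨ ⋯ ∨ T⁻⁽ⁿ⁻¹⁾ ξ` of the partition into level sets of `ξ`: its cells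
are the level sets of `x ↦ (ξ x, ξ (T x), …, ξ (Tⁿ⁻¹ x))`. -/
def iteratedJoin {X ι : Type*} (T : X → X) (ξ : X → ι) (n : ℕ) : X → (Fin n → ι) :=
  fun x i => ξ (T^[i] x)

/-- The entropy `h_μ(T, ξ) = lim_n (1/n) H_μ(ξ ∨ T⁻¹ ξ ∨ ⋯ ∨ T⁻⁽ⁿ⁻¹⁾ ξ)` of `T` with respect to a
finite partition. For measure-preserving `T` the limit exists (by subadditivity), so that
it is equal to the upper limit. -/
def entropyOfPartition {X : Type*} [MeasurableSpace X] (μ : Measure X) (T : X → X)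
    {ι : Type*} [Fintype ι] (ξ : X → ι) : EReal :=
  limsup (fun n : ℕ => ((partitionEntropy μ (iteratedJoin T ξ n) / n : ℝ) : EReal)) atTop

/-- The Kolmogorov–Sinai (measure-theoretic) entropy `h_μ(T) ∈ [0, ∞]`: the supremum of
`h_μ(T, ξ)` over all finite measurable partitions `ξ`. -/
def measureEntropy {X : Type*} [MeasurableSpace X] (μ : Measure X) (T : X → X) : EReal :=
  ⨆ (k : ℕ) (ξ : X → Fin k) (_ : Measurable ξ), entropyOfPartition μ T ξ

/-- The map `T_n x = n x (mod 1)` on the torus `ℝ / ℤ`. -/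
def torusMul (n : ℕ) : UnitAddCircle → UnitAddCircle := fun x => n • x

end

/-!
The proof is pointwise: for `μ`-almost every `x`, zero entropy makes balls about `x` so heavy that
`x` must be rational.

*Zero entropy gives heavy balls.* Let `ξ` be the partition of the circle into `p`-adic intervals of
level `k`. Comparing the measure of the cells of `ξ ∨ S⁻¹ξ ∨ ⋯ ∨ S⁻⁽ᵐ⁻¹⁾ξ`, where `S = T_p^k`, with
their product measure (Borel–Cantelli), and bounding Birkhoff sums of the information function of
`ξ` by the maximal ergodic theorem, one finds that outside a set of measure at most
`2 H_μ(ξ) / (c k)` the `p`-adic interval of level `k m` about `x` eventually has measure at least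
`exp (-c k m)` (`measureReal_not_eventually_exp_le_cell_mul_le`). As `H_μ(ξ) / k → 0`, almost every
`x` has this property for some `k`, for any prescribed `c > 0`
(`ae_exists_eventually_exp_le_measureReal_closedBall`).

*Heavy balls give rationality.* Put `b = p ^ k` and `B = b ^ m`. By invariance, a ball of radius
`B⁻⁴` about `n x`, with `n ∈ Σ` and `n ≤ B`, has at least the measure of the ball of radius `B⁻⁵`
about `x`, which is at least `B ^ (-α / 2)` for small `c`. There are at least a constant times
`B ^ α` such `n`, so these balls cannot be disjoint, and the difference `q ≤ B` of two of the
multipliers satisfies `‖q x‖ ≤ 2 B⁻⁴ ≤ B⁻³`. This holds for every large `m`, which is possible only for rational `x`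
(`exists_nsmul_eq_zero_of_eventually_rpow_le_measureReal`).

*Rationality gives finite support.* So `μ` charges the finite set of `q`-torsion points for some
`q`; that set is mapped into itself by all `T_n`, hence has full measure by ergodicity
(`support_finite_of_measure_torsion_ne_zero`).
-/

/-! ### A maximal inequality -/

/-- The running maximum `max_{0 ≤ k ≤ n} ∑_{i < k} g (Sⁱ x)` of Birkhoff sums, defined through the
recursion `M_{n+1} = max 0 (g + M_n ∘ S)`. -/
def birkhoffMax {X : Type*} (S : X → X) (g : X → ℝ) : ℕ → X → ℝ
  | 0, _ => 0
  | n + 1, x => max 0 (g x + birkhoffMax S g n (S x))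

section Maximal

variable {X : Type*} {S : X → X} {g : X → ℝ}

theorem birkhoffMax_nonneg (n : ℕ) (x : X) : 0 ≤ birkhoffMax S g n x := by
  cases n with
  | zero => exact le_rfl
  | succ n => exact le_max_left _ _

theorem birkhoffMax_le_succ (n : ℕ) (x : X) :
    birkhoffMax S g n x ≤ birkhoffMax S g (n + 1) x := by
  induction n generalizing x with
  | zero => exact birkhoffMax_nonneg _ _
  | succ n ih => exact max_le_max le_rfl (by have := ih (S x); linarith)

theorem monotone_birkhoffMax (x : X) : Monotone fun n => birkhoffMax S g n x :=
  monotone_nat_of_le_succ fun n => birkhoffMax_le_succ n x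

theorem birkhoffSum_le_birkhoffMax (n : ℕ) (x : X) :
    birkhoffSum S g n x ≤ birkhoffMax S g n x := by
  induction n generalizing x with
  | zero => simp [birkhoffMax]
  | succ n ih =>
    rw [birkhoffSum_succ']
    exact le_trans (by have := ih (S x); linarith) (le_max_right _ _)

variable [MeasurableSpace X] {μ : Measure X}

theorem integrable_birkhoffMax (hS : MeasurePreserving S μ μ) (hg : Integrable g μ) (n : ℕ) :
    Integrable (birkhoffMax S g n) μ := by
  induction n with
  | zero => exact integrable_zero _ _ _
  | succ n ih =>
    exact (integrable_zero X ℝ μ).sup (hg.add (hS.integrable_comp_of_integrable ih))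

theorem measurable_birkhoffMax (hS : Measurable S) (hg : Measurable g) (n : ℕ) :
    Measurable (birkhoffMax S g n) := by
  induction n with
  | zero => exact measurable_const
  | succ n ih => exact measurable_const.max (hg.add (ih.comp hS))

/-- The maximal ergodic theorem, by Garsia's argument: where `M_{n+1} > 0`, the recursion gives
`g = M_{n+1} - M_n ∘ S ≥ M_{n+1} - M_{n+1} ∘ S`, and the right-hand side has integral zero. -/
theorem setIntegral_birkhoffMax_pos_nonneg (hS : MeasurePreserving S μ μ) (hg : Integrable g μ)
    (hgm : Measurable g) (n : ℕ) :
    0 ≤ ∫ x in {x | 0 < birkhoffMax S g n x}, g x ∂μ := by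
  have hms : MeasurableSet {x | 0 < birkhoffMax S g n x} :=
    measurableSet_lt measurable_const (measurable_birkhoffMax hS.measurable hgm n)
  have hI := integrable_birkhoffMax hS hg n
  have hIS := hS.integrable_comp_of_integrable hI
  have h0 : ∫ x, (birkhoffMax S g n x - birkhoffMax S g n (S x)) ∂μ = 0 := by
    refine (integral_sub hI hIS).trans (sub_eq_zero.2 ?_)
    have := integral_map (μ := μ) hS.aemeasurable (f := birkhoffMax S g n)
      (by rw [hS.map_eq]; exact hI.aestronglyMeasurable)
    rwa [hS.map_eq] at this
  rw [← integral_indicator hms]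
  refine h0.symm.trans_le ?_
  refine integral_mono (hI.sub hIS) (hg.indicator hms) fun x => ?_
  by_cases hx : 0 < birkhoffMax S g n x
  · rw [Set.indicator_of_mem (by exact hx)]
    cases n with
    | zero => exact absurd hx (lt_irrefl _)
    | succ n =>
      have h1 := birkhoffMax_le_succ (S := S) (g := g) n (S x)
      have h2 : birkhoffMax S g (n + 1) x = g x + birkhoffMax S g n (S x) :=
        max_eq_right (le_of_lt ((lt_max_iff.1 hx).resolve_left (lt_irrefl _)))
      change birkhoffMax S g (n + 1) x - birkhoffMax S g (n + 1) (S x) ≤ _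
      linarith
  · rw [Set.indicator_of_notMem (by exact hx)]
    have := birkhoffMax_nonneg (S := S) (g := g) n (S x)
    dsimp only
    linarith

/-- The weak-type maximal inequality for Birkhoff averages of a nonnegative function. -/
theorem measureReal_exists_lt_birkhoffSum_mul_le [IsFiniteMeasure μ]
    (hS : MeasurePreserving S μ μ) (hg : Integrable g μ) (hgm : Measurable g)
    (hg0 : ∀ x, 0 ≤ g x) (c : ℝ) (hc : 0 ≤ c) :
    μ.real {x | ∃ n : ℕ, c * n < birkhoffSum S g n x} * c ≤ ∫ x, g x ∂μ := by
  set f : X → ℝ := fun x => g x - c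
  have hf : Integrable f μ := hg.sub (integrable_const c)
  have hfm : Measurable f := hgm.sub_const c
  set A : ℕ → Set X := fun n => {x | 0 < birkhoffMax S f n x}
  have hA : ∀ n, μ.real (A n) * c ≤ ∫ x, g x ∂μ := by
    intro n
    have h1 := setIntegral_birkhoffMax_pos_nonneg hS hf hfm n
    rw [integral_sub hg.integrableOn (integrable_const c), setIntegral_const, smul_eq_mul] at h1
    have h2 : ∫ x in A n, g x ∂μ ≤ ∫ x, g x ∂μ :=
      setIntegral_le_integral hg (Eventually.of_forall hg0)
    linarith
  have hmono : Monotone A := fun m n hmn x hx => lt_of_lt_of_le hx (monotone_birkhoffMax x hmn)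
  have hlim : Tendsto (fun n => μ.real (A n) * c) atTop (nhds (μ.real (⋃ n, A n) * c)) := by
    refine Tendsto.mul_const c ?_
    exact (ENNReal.tendsto_toReal (measure_ne_top μ _)).comp (tendsto_measure_iUnion_atTop hmono)
  refine le_trans (mul_le_mul_of_nonneg_right (measureReal_mono ?_) hc)
    (le_of_tendsto' hlim hA)
  rintro x ⟨n, hn⟩
  refine Set.mem_iUnion.2 ⟨n, lt_of_lt_of_le ?_ (birkhoffSum_le_birkhoffMax n x)⟩
  simp only [birkhoffSum, f, Finset.sum_sub_distrib, Finset.sum_const, Finset.card_range,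
    nsmul_eq_mul] at hn ⊢
  linarith

end Maximal

/-! ### The measure of typical cells -/

/-- The information function of the partition into level sets of `ξ`. It takes the junk
value `0` (as `log 0 = 0`) on the cells of measure zero. -/
noncomputable def partitionInfo {X ι : Type*} [MeasurableSpace X] (μ : Measure X) (ξ : X → ι)
    (x : X) : ℝ :=
  -Real.log (μ.real (ξ ⁻¹' {ξ x}))

section Info

variable {X ι : Type*} [MeasurableSpace X] {μ : Measure X} {ξ : X → ι}

theorem partitionInfo_nonneg [IsProbabilityMeasure μ] (x : X) : 0 ≤ partitionInfo μ ξ x :=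
  neg_nonneg.2 (Real.log_nonpos measureReal_nonneg measureReal_le_one)

theorem measurable_iteratedJoin [MeasurableSpace ι] {S : X → X} (hS : Measurable S)
    (hξ : Measurable ξ) (n : ℕ) : Measurable (iteratedJoin S ξ n) :=
  measurable_pi_lambda _ fun i => hξ.comp (hS.iterate i)

theorem ae_measureReal_cell_pos [IsFiniteMeasure μ] [Countable ι] :
    ∀ᵐ x ∂μ, 0 < μ.real (ξ ⁻¹' {ξ x}) := by
  have h : ∀ᵐ x ∂μ, ∀ j : ι, μ (ξ ⁻¹' {j}) = 0 → ξ x ≠ j := by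
    rw [ae_all_iff]
    intro j
    by_cases hj : μ (ξ ⁻¹' {j}) = 0
    · filter_upwards [measure_eq_zero_iff_ae_notMem.1 hj] with x hx _ using hx
    · exact Eventually.of_forall fun x h0 => absurd h0 hj
  filter_upwards [h] with x hx
  exact ENNReal.toReal_pos (fun h0 => hx _ h0 rfl) (measure_ne_top _ _)

variable [Fintype ι] [MeasurableSpace ι] [MeasurableSingletonClass ι]

theorem measurable_partitionInfo (hξ : Measurable ξ) : Measurable (partitionInfo μ ξ) :=
  (measurable_of_finite fun j : ι => -Real.log (μ.real (ξ ⁻¹' {j}))).comp hξ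

variable [IsProbabilityMeasure μ]

theorem integrable_partitionInfo (hξ : Measurable ξ) : Integrable (partitionInfo μ ξ) μ := by
  have : IsProbabilityMeasure (μ.map ξ) := Measure.isProbabilityMeasure_map hξ.aemeasurable
  exact (Integrable.of_finite (μ := μ.map ξ)
    (f := fun j : ι => -Real.log (μ.real (ξ ⁻¹' {j})))).comp_measurable hξ

theorem integral_partitionInfo (hξ : Measurable ξ) :
    ∫ x, partitionInfo μ ξ x ∂μ = partitionEntropy μ ξ := by
  have : IsProbabilityMeasure (μ.map ξ) := Measure.isProbabilityMeasure_map hξ.aemeasurable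
  have h := integral_map (μ := μ) hξ.aemeasurable
    (f := fun j : ι => -Real.log (μ.real (ξ ⁻¹' {j})))
    (measurable_of_finite _).aestronglyMeasurable
  unfold partitionInfo partitionEntropy
  rw [← h, integral_fintype Integrable.of_finite]
  refine Finset.sum_congr rfl fun j _ => ?_
  rw [map_measureReal_apply hξ (measurableSet_singleton j), Real.negMulLog, smul_eq_mul]
  ring

/-- The product measure with one-dimensional marginal `ξ_* μ` has total mass one, hence by
Markov's inequality its value on the cell of `x` rarely exceeds `μ` of that cell by an
exponential factor. -/
theorem measureReal_cell_lt_exp_mul_prod_le {S : X → X} (hS : Measurable S) (hξ : Measurable ξ)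
    (c : ℝ) (m : ℕ) :
    μ.real {x | μ.real (iteratedJoin S ξ m ⁻¹' {iteratedJoin S ξ m x}) <
      Real.exp (-c * m) * ∏ i : Fin m, μ.real (ξ ⁻¹' {iteratedJoin S ξ m x i})} ≤
      Real.exp (-c * m) := by
  classical
  have hJ := measurable_iteratedJoin hS hξ m
  set J := iteratedJoin S ξ m
  set Q : (Fin m → ι) → ℝ := fun w => ∏ i, μ.real (ξ ⁻¹' {w i})
  set B : Finset (Fin m → ι) :=
    Finset.univ.filter fun w => μ.real (J ⁻¹' {w}) < Real.exp (-c * m) * Q w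
  have hQ : ∑ w, Q w = 1 := by
    have h1 : ∑ j, μ.real (ξ ⁻¹' {j}) = 1 := by
      rw [sum_measureReal_preimage_singleton _ fun j _ => hξ (measurableSet_singleton j)]
      simp
    have := (Fintype.prod_sum fun (_ : Fin m) (j : ι) => μ.real (ξ ⁻¹' {j})).symm
    simpa [Q, h1] using this
  calc μ.real _ = μ.real (J ⁻¹' (B : Set (Fin m → ι))) := by
        congr 1; ext x; simp [B, J, Q]
    _ = ∑ w ∈ B, μ.real (J ⁻¹' {w}) :=
        (sum_measureReal_preimage_singleton _ fun j _ => hJ (measurableSet_singleton j)).symm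
    _ ≤ ∑ w ∈ B, Real.exp (-c * m) * Q w :=
        Finset.sum_le_sum fun w hw => (Finset.mem_filter.1 hw).2.le
    _ ≤ ∑ w, Real.exp (-c * m) * Q w :=
        Finset.sum_le_sum_of_subset_of_nonneg (Finset.subset_univ _) fun w _ _ =>
          mul_nonneg (Real.exp_pos _).le (Finset.prod_nonneg fun _ _ => measureReal_nonneg)
    _ = Real.exp (-c * m) := by rw [← Finset.mul_sum, hQ, mul_one]

/-- A quantitative form of one half of the Shannon–McMillan–Breiman theorem: outside a set of
measure at most `H_μ(ξ) / c`, the cells of the iterated joins shrink no faster than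
`exp (-2 c m)`. The information of a cell is compared with the Birkhoff sum of the information
function of `ξ` (Borel–Cantelli), and the latter is controlled by the maximal inequality. -/
theorem measureReal_not_eventually_exp_le_cell_mul_le {S : X → X} (hS : MeasurePreserving S μ μ)
    (hξ : Measurable ξ) {c : ℝ} (hc : 0 < c) :
    μ.real {x | ¬ ∀ᶠ m : ℕ in atTop, Real.exp (-(2 * c) * m) ≤
      μ.real (iteratedJoin S ξ m ⁻¹' {iteratedJoin S ξ m x})} * c ≤ partitionEntropy μ ξ := by
  rw [← integral_partitionInfo hξ]
  refine le_trans (mul_le_mul_of_nonneg_right ?_ hc.le)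
    (measureReal_exists_lt_birkhoffSum_mul_le hS (integrable_partitionInfo hξ)
      (measurable_partitionInfo hξ) partitionInfo_nonneg c hc.le)
  have hBC : ∀ᵐ x ∂μ, ∀ᶠ m : ℕ in atTop, x ∉
      {x | μ.real (iteratedJoin S ξ m ⁻¹' {iteratedJoin S ξ m x}) <
        Real.exp (-c * m) * ∏ i : Fin m, μ.real (ξ ⁻¹' {iteratedJoin S ξ m x i})} := by
    refine ae_eventually_notMem (ne_top_of_le_ne_top ?_ (ENNReal.tsum_le_tsum fun m =>
      (ENNReal.le_ofReal_iff_toReal_le (measure_ne_top _ _) (Real.exp_pos _).le).2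
        (measureReal_cell_lt_exp_mul_prod_le hS.measurable hξ c m)))
    have hs : Summable fun m : ℕ => Real.exp (-c * m) := by
      have := summable_geometric_of_lt_one (Real.exp_pos (-c)).le
        (by simpa using hc)
      refine this.congr fun m => ?_
      rw [← Real.exp_nat_mul, mul_comm]
    exact hs.tsum_ofReal_ne_top
  have hpos : ∀ᵐ x ∂μ, ∀ i : ℕ, 0 < μ.real (ξ ⁻¹' {ξ (S^[i] x)}) :=
    ae_all_iff.2 fun i => (hS.iterate i).quasiMeasurePreserving.ae ae_measureReal_cell_pos
  refine ENNReal.toReal_mono (measure_ne_top _ _) (measure_mono_ae ?_)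
  filter_upwards [hBC, hpos] with x hx hp hbad
  by_contra hno
  refine hbad ?_
  filter_upwards [hx] with m hm
  have hB : birkhoffSum S (partitionInfo μ ξ) m x ≤ c * m := by
    by_contra h
    exact hno ⟨m, not_le.1 h⟩
  have hprod : ∏ i : Fin m, μ.real (ξ ⁻¹' {iteratedJoin S ξ m x i}) =
      Real.exp (-birkhoffSum S (partitionInfo μ ξ) m x) := by
    rw [birkhoffSum, ← Finset.sum_neg_distrib, Real.exp_sum, ← Fin.prod_univ_eq_prod_range
      (fun i => Real.exp (-partitionInfo μ ξ (S^[i] x)))]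
    refine Finset.prod_congr rfl fun i _ => ?_
    rw [partitionInfo, neg_neg, Real.exp_log (hp i)]
    rfl
  refine le_trans ?_ (not_lt.1 hm)
  rw [hprod, ← Real.exp_add]
  exact Real.exp_le_exp.2 (by linarith)

end Info

/-! ### Digit expansions on the circle -/

namespace UnitAddCircle

/-- The representative in `[0, 1)` of a point of the circle `ℝ / ℤ`. -/
noncomputable def rep (x : UnitAddCircle) : ℝ := AddCircle.equivIco 1 0 x

theorem rep_nonneg (x : UnitAddCircle) : 0 ≤ rep x := (AddCircle.equivIco 1 0 x).2.1

theorem rep_lt_one (x : UnitAddCircle) : rep x < 1 :=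
  (AddCircle.equivIco (1 : ℝ) 0 x).2.2.trans_eq (zero_add 1)

theorem coe_rep (x : UnitAddCircle) : (rep x : UnitAddCircle) = x := AddCircle.coe_equivIco

theorem measurable_rep : Measurable rep :=
  measurable_subtype_coe.comp (AddCircle.measurableEquivIco 1 0).measurable

theorem rep_nsmul (n : ℕ) (x : UnitAddCircle) : rep (n • x) = Int.fract (n * rep x) := by
  have h : n • x = ((n * rep x : ℝ) : UnitAddCircle) := by
    conv_lhs => rw [← coe_rep x]
    rw [← AddCircle.coe_nsmul, nsmul_eq_mul]
  rw [h]
  refine (AddCircle.coe_equivIco_mk_apply (p := (1 : ℝ)) (n * rep x)).trans ?_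
  rw [div_one, mul_one]

/-- The leading digit of `x ∈ [0, 1)` in base `p`. -/
noncomputable def digit (p : ℕ) (hp : 0 < p) (x : UnitAddCircle) : Fin p :=
  ⟨⌊p * rep x⌋₊, (Nat.floor_lt (by have := rep_nonneg x; positivity)).2 (by
    have := rep_lt_one x
    have h : (0 : ℝ) < p := by exact_mod_cast hp
    nlinarith)⟩

theorem measurable_digit (p : ℕ) (hp : 0 < p) : Measurable (digit p hp) := by
  refine measurable_to_countable' fun j => ?_
  have : digit p hp ⁻¹' {j} = (fun x => ⌊p * rep x⌋₊) ⁻¹' {(j : ℕ)} := by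
    ext x; simp [digit, Fin.ext_iff]
  rw [this]
  exact (Nat.measurable_floor.comp (measurable_rep.const_mul _)) (measurableSet_singleton _)

theorem abs_rep_sub_rep_le_of_digit_eq {p : ℕ} (hp : 0 < p) {x y : UnitAddCircle} {n : ℕ}
    (h : ∀ i < n, digit p hp ((torusMul p)^[i] x) = digit p hp ((torusMul p)^[i] y)) :
    |rep x - rep y| ≤ ((p : ℝ) ^ n)⁻¹ := by
  induction n generalizing x y with
  | zero =>
    have := rep_nonneg x; have := rep_nonneg y; have := rep_lt_one x; have := rep_lt_one y
    rw [abs_le]; constructor <;> norm_num <;> linarith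
  | succ n ih =>
    have hp' : (0 : ℝ) < p := by exact_mod_cast hp
    have h1 := ih (x := torusMul p x) (y := torusMul p y) fun i hi => h (i + 1) (by omega)
    have h2 : ⌊(p : ℝ) * rep x⌋₊ = ⌊(p : ℝ) * rep y⌋₊ := congrArg Fin.val (h 0 (by omega))
    have h3 : ⌊(p : ℝ) * rep x⌋ = ⌊(p : ℝ) * rep y⌋ := by
      have hx := rep_nonneg x; have hy := rep_nonneg y
      rw [← Int.natCast_floor_eq_floor (by positivity), ← Int.natCast_floor_eq_floor (by positivity),
        h2]
    have h4 : rep (torusMul p x) - rep (torusMul p y) = p * (rep x - rep y) := by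
      rw [torusMul, torusMul, rep_nsmul, rep_nsmul, Int.fract, Int.fract, h3]; ring
    rw [h4, abs_mul, abs_of_pos hp'] at h1
    rw [pow_succ', mul_inv, ← div_eq_inv_mul, le_div_iff₀ hp', mul_comm]
    exact h1

theorem dist_le_abs_rep_sub_rep (x y : UnitAddCircle) : dist x y ≤ |rep x - rep y| := by
  rw [dist_eq_norm]
  conv_lhs => rw [← coe_rep x, ← coe_rep y, ← AddCircle.coe_sub, UnitAddCircle.norm_eq]
  simpa using round_le (rep x - rep y) 0

end UnitAddCircle

open UnitAddCircle

/-- A cell of the `m`-fold join, under `T_p^k`, of the partition into `p`-adic intervals of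
level `k` is a `p`-adic interval of level `k m`. -/
theorem iteratedJoin_iteratedJoin_digit_subset_closedBall {p : ℕ} (hp : 0 < p) {k : ℕ} (hk : 0 < k)
    (m : ℕ) (x : UnitAddCircle) :
    iteratedJoin (torusMul p)^[k] (iteratedJoin (torusMul p) (digit p hp) k) m ⁻¹'
      {iteratedJoin (torusMul p)^[k] (iteratedJoin (torusMul p) (digit p hp) k) m x} ⊆
    Metric.closedBall x (((p : ℝ) ^ k) ^ m)⁻¹ := by
  intro y hy
  rw [Metric.mem_closedBall, ← pow_mul]
  refine (dist_le_abs_rep_sub_rep y x).trans (abs_rep_sub_rep_le_of_digit_eq hp fun i hi => ?_)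
  have h1 := congrFun (congrFun hy ⟨i / k, Nat.div_lt_of_lt_mul hi⟩) ⟨i % k, Nat.mod_lt _ hk⟩
  simp only [iteratedJoin, ← Function.iterate_mul, ← Function.iterate_add_apply,
    Nat.mod_add_div] at h1
  exact h1

/-- If `T_p` has zero entropy, then `μ` has dimension zero in the following strong sense: at almost
every point and along some geometric sequence of radii `b⁻ᵐ`, the measure of balls eventually
exceeds any prescribed small power of the radius. -/
theorem ae_exists_eventually_exp_le_measureReal_closedBall {μ : Measure UnitAddCircle}
    [IsProbabilityMeasure μ] {p : ℕ} (hp : 0 < p) (hT : MeasurePreserving (torusMul p) μ μ)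
    (hent : measureEntropy μ (torusMul p) = 0) {c : ℝ} (hc : 0 < c) :
    ∀ᵐ x ∂μ, ∃ k : ℕ, 0 < k ∧ ∀ᶠ m : ℕ in atTop,
      Real.exp (-c * k * m) ≤ μ.real (Metric.closedBall x (((p : ℝ) ^ k) ^ m)⁻¹) := by
  have hH : entropyOfPartition μ (torusMul p) (digit p hp) ≤ 0 := by
    rw [← hent]
    exact le_iSup_of_le p (le_iSup_of_le (digit p hp) (le_iSup_of_le (measurable_digit p hp) le_rfl))
  have hsmall : ∀ ε : ℝ, 0 < ε → μ.real {x | ¬ ∃ k : ℕ, 0 < k ∧ ∀ᶠ m : ℕ in atTop,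
      Real.exp (-c * k * m) ≤ μ.real (Metric.closedBall x (((p : ℝ) ^ k) ^ m)⁻¹)} ≤ ε := by
    intro ε hε
    have hlt : ∀ᶠ k : ℕ in atTop,
        ((partitionEntropy μ (iteratedJoin (torusMul p) (digit p hp) k) / k : ℝ) : EReal) <
          ((ε * (c / 2) : ℝ) : EReal) :=
      eventually_lt_of_limsup_lt (hH.trans_lt (by exact_mod_cast (by positivity : 0 < ε * (c / 2))))
    obtain ⟨k, hk1, hk⟩ := (hlt.and (eventually_gt_atTop 0)).exists
    have hk' : (0 : ℝ) < k := by exact_mod_cast hk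
    rw [EReal.coe_lt_coe_iff, div_lt_iff₀ hk'] at hk1
    have hck : 0 < c / 2 * k := by positivity
    have h := measureReal_not_eventually_exp_le_cell_mul_le (hT.iterate k)
      (measurable_iteratedJoin hT.measurable (measurable_digit p hp) k) hck
    refine le_of_mul_le_mul_right ?_ hck
    refine le_trans (mul_le_mul_of_nonneg_right (measureReal_mono ?_) hck.le)
      (h.trans (hk1.le.trans_eq (by ring)))
    intro x hx hev
    refine hx ⟨k, hk, hev.mono fun m hm => ?_⟩
    refine le_trans (Real.exp_le_exp.2 (le_of_eq (by ring))) (hm.trans (measureReal_mono ?_))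
    exact iteratedJoin_iteratedJoin_digit_subset_closedBall hp hk m x
  rw [ae_iff]
  have h0 := le_of_forall_pos_le_add (a := μ.real _) (b := 0) fun ε hε =>
    (hsmall ε hε).trans_eq (zero_add ε).symm
  exact (measureReal_eq_zero_iff).1 (le_antisymm h0 measureReal_nonneg)

/-! ### Points with many clustering multiples are rational -/

/-- A point with an approximation `‖q x‖ ≤ B⁻³`, `1 ≤ q ≤ B`, for every large power `B = bᵐ` is
rational: consecutive approximating fractions have too small denominators to be distinct. -/
theorem exists_nsmul_eq_zero_of_eventually_norm_nsmul_le {b : ℕ} (hb : 2 ≤ b) {x : UnitAddCircle}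
    (h : ∀ᶠ m : ℕ in atTop, ∃ q : ℕ, 1 ≤ q ∧ q ≤ b ^ m ∧ ‖q • x‖ ≤ (((b : ℝ) ^ m) ^ 3)⁻¹) :
    ∃ q : ℕ, 1 ≤ q ∧ q • x = 0 := by
  obtain ⟨t, rfl⟩ : ∃ t : ℝ, (t : UnitAddCircle) = x := ⟨rep x, coe_rep x⟩
  have hb' : (2 : ℝ) ≤ b := by exact_mod_cast hb
  obtain ⟨m₀, hm₀⟩ := eventually_atTop.1 (h.and (eventually_ge_atTop 2))
  choose! q hq1 hqb hq using fun m hm => (hm₀ m hm).1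
  set a : ℕ → ℤ := fun m => round (q m * t)
  have hqa : ∀ m ≥ m₀, |q m * t - a m| ≤ (((b : ℝ) ^ m) ^ 3)⁻¹ := by
    intro m hm
    have := hq m hm
    rwa [← AddCircle.coe_nsmul, nsmul_eq_mul, UnitAddCircle.norm_eq] at this
  have hstep : ∀ m ≥ m₀, (q m * a (m + 1) : ℤ) = q (m + 1) * a m := by
    intro m hm
    have hm2 : 2 ≤ m := (hm₀ m hm).2
    set B : ℝ := (b : ℝ) ^ m
    have hB : b ^ 2 ≤ B := pow_le_pow_right₀ (by linarith) hm2
    have hBpos : 0 < B := by positivity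
    have h1 := hqa m hm
    have h2 := hqa (m + 1) (by omega)
    have hq1' : (q m : ℝ) ≤ B := by
      have := hqb m hm
      simp only [B]
      exact_mod_cast this
    have hq2' : (q (m + 1) : ℝ) ≤ b * B := by
      have := hqb (m + 1) (by omega)
      rw [pow_succ'] at this
      simp only [B]
      exact_mod_cast this
    have h2' : |q (m + 1) * t - a (m + 1)| ≤ (B ^ 3)⁻¹ := h2.trans <|
      inv_anti₀ (by positivity) (pow_le_pow_left₀ hBpos.le
        (pow_le_pow_right₀ (by linarith) (Nat.le_succ m)) 3)
    have hlt : |((q m * a (m + 1) - q (m + 1) * a m : ℤ) : ℝ)| < 1 := by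
      have e : ((q m * a (m + 1) - q (m + 1) * a m : ℤ) : ℝ) =
          q (m + 1) * (q m * t - a m) - q m * (q (m + 1) * t - a (m + 1)) := by
        push_cast; ring
      rw [e]
      refine lt_of_le_of_lt (abs_sub _ _) ?_
      rw [abs_mul, abs_mul, Nat.abs_cast, Nat.abs_cast]
      have h3 : q (m + 1) * |q m * t - a m| ≤ b * B * (B ^ 3)⁻¹ := by gcongr
      have h4 : q m * |q (m + 1) * t - a (m + 1)| ≤ B * (B ^ 3)⁻¹ := by gcongr
      have h5 : b * B * (B ^ 3)⁻¹ + B * (B ^ 3)⁻¹ < 1 := by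
        rw [← add_mul, ← div_eq_mul_inv, div_lt_one (by positivity)]
        have : (b : ℝ) + 1 < B := by nlinarith
        have : 1 < B := by linarith
        nlinarith [mul_pos hBpos hBpos]
      linarith
    have hz : |(q m * a (m + 1) - q (m + 1) * a m : ℤ)| < 1 := by exact_mod_cast hlt
    exact sub_eq_zero.1 (Int.abs_lt_one_iff.1 hz)
  have hqpos : ∀ m ≥ m₀, (0 : ℝ) < q m := fun m hm => by exact_mod_cast hq1 m hm
  have hratio : ∀ m ≥ m₀, (a m / q m : ℝ) = a m₀ / q m₀ := by
    intro m hm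
    induction m, hm using Nat.le_induction with
    | base => rfl
    | succ m hm ih =>
      rw [← ih, div_eq_div_iff (hqpos _ (by omega)).ne' (hqpos _ hm).ne']
      have := hstep m hm
      have : (q m * a (m + 1) : ℝ) = q (m + 1) * a m := by exact_mod_cast this
      linarith
  have hlim : Tendsto (fun m : ℕ => ((b : ℝ) ^ m)⁻¹) atTop (nhds 0) :=
    (tendsto_pow_atTop_atTop_of_one_lt (by linarith)).inv_tendsto_atTop
  have ht : |t - a m₀ / q m₀| ≤ 0 := by
    refine ge_of_tendsto hlim ?_
    filter_upwards [eventually_ge_atTop m₀] with m hm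
    rw [← hratio m hm]
    have hpos := hqpos m hm
    have h1 : (1 : ℝ) ≤ q m := by exact_mod_cast hq1 m hm
    have e : |t - a m / q m| * q m = |q m * t - a m| := by
      rw [← abs_of_pos hpos, ← abs_mul, abs_of_pos hpos]
      congr 1
      field_simp
    have hB1 : 1 ≤ (b : ℝ) ^ m := one_le_pow₀ (by linarith)
    calc |t - a m / q m| ≤ |t - a m / q m| * q m := le_mul_of_one_le_right (abs_nonneg _) h1
      _ ≤ (((b : ℝ) ^ m) ^ 3)⁻¹ := e.trans_le (hqa m hm)
      _ ≤ ((b : ℝ) ^ m)⁻¹ := by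
        gcongr
        exact le_self_pow₀ hB1 (by norm_num)
  refine ⟨q m₀, hq1 m₀ le_rfl, ?_⟩
  have ht' : (q m₀ : ℝ) * t = a m₀ := by
    have := sub_eq_zero.1 (abs_eq_zero.1 (le_antisymm ht (abs_nonneg _)))
    rw [this, mul_div_cancel₀ _ (hqpos m₀ le_rfl).ne']
  rw [← AddCircle.coe_nsmul, nsmul_eq_mul, ht', AddCircle.coe_eq_zero_iff]
  exact ⟨a m₀, by simp⟩

/-- If `μ` is invariant under the multiplications by elements of `A` and the points `n x`, `n ∈ A`,
are pairwise more than `2 r` apart, then the balls of radius `r` about them are disjoint and each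
has at least the measure of the ball of radius `s ≤ r / N` about `x`. -/
theorem card_mul_measureReal_closedBall_le_one {μ : Measure UnitAddCircle} [IsProbabilityMeasure μ]
    {A : Finset ℕ} {N : ℕ} {r s : ℝ} (hA : ∀ n ∈ A, MeasurePreserving (torusMul n) μ μ)
    (hAN : ∀ n ∈ A, n ≤ N) (hrs : N * s ≤ r) {x : UnitAddCircle}
    (hsep : ∀ n ∈ A, ∀ n' ∈ A, n < n' → 2 * r < ‖(n' - n) • x‖) :
    A.card * μ.real (Metric.closedBall x s) ≤ 1 := by
  have hball : ∀ n ∈ A,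
      μ.real (Metric.closedBall x s) ≤ μ.real (Metric.closedBall (n • x) r) := by
    intro n hn
    have hpre := (hA n hn).measureReal_preimage
      (s := Metric.closedBall (n • x) r) Metric.isClosed_closedBall.nullMeasurableSet
    rw [← hpre]
    refine measureReal_mono fun y hy => ?_
    rw [Set.mem_preimage, Metric.mem_closedBall, torusMul, dist_eq_norm, ← nsmul_sub]
    rw [Metric.mem_closedBall, dist_eq_norm] at hy
    have hnN : (n : ℝ) ≤ N := by exact_mod_cast hAN n hn
    exact norm_nsmul_le.trans ((mul_le_mul hnN hy (norm_nonneg _) (Nat.cast_nonneg _)).trans hrs)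
  have hlt : ∀ n ∈ A, ∀ n' ∈ A, n < n' →
      Disjoint (Metric.closedBall (n • x) r) (Metric.closedBall (n' • x) r) := by
    intro n hn n' hn' hlt
    refine Metric.closedBall_disjoint_closedBall ?_
    rw [dist_comm, dist_eq_norm, sub_eq_add_neg, ← sub_nsmul x hlt.le]
    linarith [hsep n hn n' hn' hlt]
  have hdisj : (A : Set ℕ).PairwiseDisjoint fun n => Metric.closedBall (n • x) r := by
    intro n hn n' hn' hne
    rcases lt_or_gt_of_ne hne with h | h
    · exact hlt n hn n' hn' h
    · exact (hlt n' hn' n hn h).symm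
  calc A.card * μ.real (Metric.closedBall x s)
      = ∑ n ∈ A, μ.real (Metric.closedBall x s) := by rw [Finset.sum_const, nsmul_eq_mul]
    _ ≤ ∑ n ∈ A, μ.real (Metric.closedBall (n • x) r) := Finset.sum_le_sum hball
    _ = μ.real (⋃ n ∈ A, Metric.closedBall (n • x) r) :=
        (measureReal_biUnion_finset hdisj fun n _ => Metric.isClosed_closedBall.measurableSet).symm
    _ ≤ 1 := measureReal_le_one

/-- A point around which balls of radius `b⁻ᵐ` have measure at least `b ^ (-α m / 10)` is rational,
if `μ` is invariant under the multiplications by the elements of a set `A` of polynomial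
growth `N ^ α`. -/
theorem exists_nsmul_eq_zero_of_eventually_rpow_le_measureReal {μ : Measure UnitAddCircle}
    [IsProbabilityMeasure μ] {A : Set ℕ} (hA : ∀ n ∈ A, MeasurePreserving (torusMul n) μ μ)
    {α δ : ℝ} (hα : 0 < α) (hδ : 0 < δ)
    (hcard : ∀ᶠ N : ℕ in atTop, δ * (N : ℝ) ^ α ≤ (A ∩ Set.Icc 1 N).ncard)
    {b : ℕ} (hb : 2 ≤ b) {x : UnitAddCircle}
    (hx : ∀ᶠ m : ℕ in atTop,
      ((b : ℝ) ^ m) ^ (-(α / 10)) ≤ μ.real (Metric.closedBall x ((b : ℝ) ^ m)⁻¹)) :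
    ∃ q : ℕ, 1 ≤ q ∧ q • x = 0 := by
  have hb' : (1 : ℝ) < b := by exact_mod_cast hb
  have hbpow : Tendsto (fun m : ℕ => b ^ m) atTop atTop := tendsto_pow_atTop_atTop_of_one_lt hb
  have hbpow' : Tendsto (fun m : ℕ => (b : ℝ) ^ m) atTop atTop :=
    tendsto_pow_atTop_atTop_of_one_lt hb'
  have hgrow : ∀ᶠ m : ℕ in atTop, 1 < δ * ((b : ℝ) ^ m) ^ (α / 2) :=
    ((((tendsto_rpow_atTop (half_pos hα)).comp hbpow').const_mul_atTop hδ).eventually_gt_atTop 1)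
  -- Heavy balls are used at radius `B⁻⁵`, `B = b ^ m`: one factor `B` is lost to multiplication by
  -- `n ≤ B`, another to the comparison `2 B⁻⁴ ≤ B⁻³`.
  have h5 : Tendsto (fun m : ℕ => 5 * m) atTop atTop :=
    tendsto_id.const_mul_atTop' (by norm_num)
  refine exists_nsmul_eq_zero_of_eventually_norm_nsmul_le hb ?_
  filter_upwards [hbpow.eventually hcard, hgrow, h5.eventually hx, eventually_ge_atTop 1]
    with m hm1 hm2 hm3 hm4
  set B : ℝ := (b : ℝ) ^ m with hBdef
  have hBb : (b : ℝ) ≤ B := le_self_pow₀ hb'.le (by omega)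
  have hb2 : (2 : ℝ) ≤ b := by exact_mod_cast hb
  have hBpos : 0 < B := by linarith
  by_contra! hno
  have hfin : (A ∩ Set.Icc 1 (b ^ m)).Finite := (Set.finite_Icc 1 (b ^ m)).inter_of_right A
  set F := hfin.toFinset
  have hF : ∀ n ∈ F, n ∈ A ∧ 1 ≤ n ∧ n ≤ b ^ m := fun n hn => by
    simpa [F] using hn
  have hle := card_mul_measureReal_closedBall_le_one (μ := μ) (A := F) (N := b ^ m)
    (r := (B ^ 4)⁻¹) (s := (B ^ 5)⁻¹) (x := x) (fun n hn => hA n (hF n hn).1)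
    (fun n hn => (hF n hn).2.2) (le_of_eq (by push_cast; rw [← hBdef]; field_simp)) ?_
  · rw [Set.ncard_eq_toFinset_card _ hfin] at hm1
    have e : (b : ℝ) ^ (5 * m) = B ^ 5 := by rw [mul_comm, pow_mul]
    rw [e, ← Real.rpow_natCast B 5, ← Real.rpow_mul hBpos.le] at hm3
    rw [← Real.rpow_natCast B 5] at hle
    push_cast at hm1 hm3 hle
    rw [← hBdef] at hm1
    -- `B ^ α` disjoint balls of measure `B ^ (-α / 2)` have total measure `B ^ (α / 2)`.
    have h6 : δ * B ^ α * B ^ (5 * -(α / 10)) ≤ 1 :=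
      (mul_le_mul hm1 hm3 (Real.rpow_nonneg hBpos.le _) (Nat.cast_nonneg _)).trans hle
    rw [mul_assoc, ← Real.rpow_add hBpos] at h6
    have e2 : α + 5 * -(α / 10) = α / 2 := by ring
    rw [e2] at h6
    linarith
  · intro n hn n' hn' hlt
    have h1 := hno (n' - n) (by omega) ((Nat.sub_le _ _).trans (hF n' hn').2.2)
    refine lt_of_le_of_lt ?_ h1
    rw [← div_eq_mul_inv, div_le_iff₀ (by positivity)]
    have : (B ^ 3)⁻¹ * B ^ 4 = B := by field_simp
    linarith

/-! ### Conclusion -/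

/-- The `q`-torsion of the circle is finite and mapped into itself by every `T_n`, so that an
ergodic measure which charges it is carried by it. -/
theorem support_finite_of_measure_torsion_ne_zero {S : Subsemigroup ℕ}
    {μ : Measure UnitAddCircle} [IsProbabilityMeasure μ] (hμ : ErgodicSMul S UnitAddCircle μ)
    {q : ℕ} (hq : 1 ≤ q) (h0 : μ {x | q • x = 0} ≠ 0) : μ.support.Finite := by
  set F : Set UnitAddCircle := {x | q • x = 0}
  have hF : F.Finite := AddCircle.finite_torsion 1 hq
  have hc := hμ.aeconst_of_forall_preimage_smul_ae_eq hF.measurableSet fun g => by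
    refine (ae_eq_of_subset_of_measure_ge (fun x hx => ?_)
      (hμ.measure_preimage_smul g hF.measurableSet).le hF.measurableSet.nullMeasurableSet
      (measure_ne_top _ _)).symm
    change q • ((g : ℕ) • x) = 0
    rw [smul_comm, show q • x = 0 from hx, smul_zero]
  rcases eventuallyConst_set'.1 hc with h | h
  · exact absurd (measure_eq_zero_iff_ae_notMem.2 (h.mono fun _ hx hxF => hx.mp hxF)) h0
  · refine hF.subset (Measure.support_subset_of_isClosed hF.isClosed 
      (h.mono fun _ hx => hx.mpr trivial))

theorem lemma3p2 (α : ℝ) (hα : 0 < α)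
    -- a multiplicative semigroup of positive integers
    (S : Subsemigroup ℕ) (hS : ∀ n ∈ S, 1 ≤ n)
    (hdens : 0 < liminf (fun N : ℕ =>
      (((((S : Set ℕ) ∩ Set.Icc 1 N).ncard : ℝ) / (N : ℝ) ^ α : ℝ) : EReal)) atTop)
    (μ : Measure UnitAddCircle) [IsProbabilityMeasure μ]
    -- `μ` is invariant and ergodic for the action `n • x = n x (mod 1)` of the whole semigroup
    (hμ : ErgodicSMul S UnitAddCircle μ)
    (p : ℕ) (hpS : p ∈ S) (hp : 2 ≤ p)
    (hent : measureEntropy μ (torusMul p) = 0) :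
    μ.support.Finite := by
  have hT : ∀ n ∈ (S : Set ℕ), MeasurePreserving (torusMul n) μ μ := by
    intro n hn
    have hm : Measurable (torusMul n) := (continuous_nsmul n).measurable
    refine ⟨hm, Measure.ext fun s hs => ?_⟩
    rw [Measure.map_apply hm hs]
    exact hμ.measure_preimage_smul ⟨n, hn⟩ hs
  obtain ⟨δ, hδ0, hδ⟩ := EReal.lt_iff_exists_real_btwn.1 hdens
  have hδ0' : 0 < δ := by exact_mod_cast hδ0
  have hcard : ∀ᶠ N : ℕ in atTop,
      δ * (N : ℝ) ^ α ≤ ((S : Set ℕ) ∩ Set.Icc 1 N).ncard := by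
    filter_upwards [eventually_lt_of_lt_liminf hδ, eventually_gt_atTop 0] with N hN hN0
    have hN0' : (0 : ℝ) < N := by exact_mod_cast hN0
    rw [EReal.coe_lt_coe_iff, lt_div_iff₀ (Real.rpow_pos_of_pos hN0' α)] at hN
    exact hN.le
  have hp0 : (0 : ℝ) < p := by positivity
  have hlog : 0 < Real.log p := Real.log_pos (by exact_mod_cast hp)
  have hrat : ∀ᵐ x ∂μ, ∃ q : ℕ, 1 ≤ q ∧ q • x = 0 := by
    filter_upwards [ae_exists_eventually_exp_le_measureReal_closedBall (by omega) (hT p hpS) hent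
      (c := α / 10 * Real.log p) (by positivity)] with x hx
    obtain ⟨k, hk, hkm⟩ := hx
    refine exists_nsmul_eq_zero_of_eventually_rpow_le_measureReal hT hα hδ0' hcard (b := p ^ k)
      (hp.trans (Nat.le_self_pow hk.ne' p)) (hkm.mono fun m hm => ?_)
    push_cast
    refine le_trans (le_of_eq ?_) hm
    rw [← pow_mul, Real.rpow_def_of_pos (by positivity), Real.log_pow]
    congr 1
    push_cast
    ring
  obtain ⟨q, hq, hq0⟩ : ∃ q : ℕ, 1 ≤ q ∧ μ {x | q • x = 0} ≠ 0 := by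
    by_contra! hno
    have hall : ∀ᵐ x ∂μ, ∀ q : ℕ, 1 ≤ q → q • x ≠ 0 := by
      rw [ae_all_iff]
      intro q
      by_cases hq : 1 ≤ q
      · filter_upwards [measure_eq_zero_iff_ae_notMem.1 (hno q hq)] with x hx _ using hx
      · exact Eventually.of_forall fun x h => absurd h hq
    obtain ⟨x, hx, q, hq, hqx⟩ := (hall.and hrat).exists
    exact hx q hq hqx
  exact support_finite_of_measure_torsion_ne_zero hμ hq hq0
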